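/- Let $n\ge 1$ and let $\Delta=\{x\in\mathbb R^n : x_i\ge 0,\ \sum_i x_i=1\}$, where $x\in\Delta$ stands for the division of the cake $[0,1]$ into the $n$ consecutive slices $(x_1+\dots+x_{i-1},\,x_1+\dots+x_i)$, $1\le i\le n$ (slice $i$ is empty iff $x_i=0$). The preferences of a person are given by sets $C_1,\dots,C_n\subseteq\Delta$ with $\bigcup_i C_i=\Delta$, where $x\in C_i$ means that in the division $x$ the person weakly prefers slice $i$, i.e. likes it at least as much as every other slice. The person is hungry if any nonempty slice is at least as good as any empty one: whenever $x_i>0$, $x_k=0$ and $x\in C_k$, also $x\in C_i$ (in particular this holds if an empty slice is never weakly preferred). An assignment of the slices of $x$ to $n$ people, one slice each, is envy-free if each person receives a slice that he or she weakly prefers. Envy-free cake divisions exist for any number of people even if the preferences of one person are secret. Precisely: consider $n$ people, one of whom, $s$, has secret preferences, and suppose that each person $j\ne s$ is hungry and has closed preference sets $C^j_1,\dots,C^j_n$. Then there is a division $x\in\Delta$, depending only on the preferences of the people $j\neq s$, such that (a) for every slice $i$ (the one picked by $s$) there is a bijection $\pi_i$ from the people other than $s$ to the slices other than $i$ with $x\in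 C^j_{\pi_i(j)}$ for all $j\ne s$; and (b) whatever the preferences of $s$ are, the slices of $x$ can be assigned to all $n$ people in an envy-free way. -/

import Mathlib

/-- A division of the cake `[0, 1]` into `n` consecutive slices, given by the tuple
`(x_0, …, x_{n-1})` of slice lengths: a point of the standard simplex. -/
abbrev CakeDivision (n : ℕ) : Type := stdSimplex ℝ (Fin n)

/-- The `i`-th slice of the division `x`: the interval from `x_0 + ⋯ + x_{i-1}` to
`x_0 + ⋯ + x_i`. -/
def CakeDivision.slice {n : ℕ} (x : CakeDivision n) (i : Fin n) : Set ℝ :=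
  Set.Ioo (∑ k ∈ Finset.Iio i, x.1 k) (∑ k ∈ Finset.Iic i, x.1 k)

theorem CakeDivision.slice_nonempty_iff {n : ℕ} (x : CakeDivision n) (i : Fin n) :
    (x.slice i).Nonempty ↔ 0 < x.1 i := by
  have h : ∑ k ∈ Finset.Iic i, x.1 k = x.1 i + ∑ k ∈ Finset.Iio i, x.1 k := by
    rw [← Finset.Iio_insert, Finset.sum_insert (by simp)]
  rw [CakeDivision.slice, Set.nonempty_Ioo, h]
  exact lt_add_iff_pos_left _

/-- The subjective preferences of one person: `prefSet i` is the set of divisions in which the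
person weakly prefers slice `i` (likes it at least as much as every other slice of that division).
In every division at least one slice is weakly preferred. -/
structure CakePreferences (n : ℕ) where
  prefSet : Fin n → Set (CakeDivision n)
  exists_preferred : ∀ x : CakeDivision n, ∃ i, x ∈ prefSet i

/-- The person is hungry: any nonempty slice is at least as good as any empty one, that is, an
empty slice is among the most preferred slices of a division only if every nonempty slice is.
(A person who never puts an empty slice among the most preferred ones is hungry in this sense.) -/
def CakePreferences.IsHungry {n : ℕ} (P : CakePreferences n) : Prop :=
  ∀ (x : CakeDivision n) (i k : Fin n), (x.slice i).Nonempty → x.slice k = ∅ →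
    x ∈ P.prefSet k → x ∈ P.prefSet i

/-- All preference sets are closed. -/
def CakePreferences.HasClosedPrefSets {n : ℕ} (P : CakePreferences n) : Prop :=
  ∀ i : Fin n, IsClosed (P.prefSet i)

/-- The assignment `σ` of the slices of `x` to the `n` people, person `j` receiving slice `σ j`,
is envy-free: every person receives a slice that he or she weakly prefers. -/
def IsEnvyFree {n : ℕ} (P : Fin n → CakePreferences n) (x : CakeDivision n)
    (σ : Fin n ≃ Fin n) : Prop :=
  ∀ j : Fin n, x ∈ (P j).prefSet (σ j)

/-!
The theorem is the statement that, at a suitable division `x`, the bipartite graph between the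
`n - 1` people with known preferences and the `n` slices they weakly prefer satisfies Hall's
condition with a surplus of one: every nonempty set `A` of people weakly prefers, between them, more
than `|A|` slices. Hall's theorem then gives a matching that avoids any prescribed slice
(`exists_equiv_ne_of_card_lt`), namely the one picked by the person with secret preferences.

To find `x`, each person's preferences are replaced by a partition of unity on the simplex whose
`i`-th member vanishes where the `i`-th slice is empty and where slice `i` is far from being
preferred; hunger is what makes this possible. At a given division these values form a matrix with
one row of sum `1` for each person. If every column sum is at most `(n - 1) / n`, then the rows of
`A` meet at least `|A| n / (n - 1) > |A|` columns. Such a division exists by the dual form of the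
Knaster–Kuratowski–Mazurkiewicz lemma (`exists_forall_pos_mem_of_isClosed_cover`), and compactness
makes the approximation exact (`exists_card_lt_card_neighbors`).

The dual KKM lemma is derived from Scarf's combinatorial lemma `exists_rainbow_isDominant`, which
concerns a finite set with several linear orders and takes the place of a triangulation with
Sperner's lemma. Its proof is a parity argument: "rooms" are dominant sets with as many elements as
there are orders, "doors" are sets with one element fewer that show all colors but a fixed one, and
inclusions of doors in rooms are counted in two ways. Each door is in an even number of rooms, save
one, which is in a single room; a room that is not rainbow has an even number of doors.
-/

/-! ### Scarf's lemma -/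

/-- Given a family of orders on `E`, the `i`-th one being the comparison of the values of `v i`, a
finite set `S` is dominant if no element of `E` lies strictly above a minimum of `S` in every
order: each `y` is, in at least one order, at most every element of `S`. -/
def IsDominant {I E α : Type*} [LE α] (v : I → E → α) (S : Finset E) : Prop :=
  ∀ y, ∃ i, ∀ x ∈ S, v i y ≤ v i x

namespace IsDominant

variable {I E α : Type*} [LinearOrder α] {v : I → E → α} {S τ : Finset E}

theorem mono (h : IsDominant v S) (hτ : τ ⊆ S) : IsDominant v τ := fun y =>
  (h y).imp fun _ hi x hx => hi x (hτ hx)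

/-- Dominance applied to the elements of `S` itself: each of them is the minimum of `S` in some
order. -/
theorem exists_argmin_eq (hv : ∀ i, Function.Injective (v i)) (h : IsDominant v S)
    {m : I → E} (hm : ∀ i, m i ∈ S ∧ ∀ x ∈ S, v i (m i) ≤ v i x) {y : E} (hy : y ∈ S) :
    ∃ i, m i = y := by
  obtain ⟨i, hi⟩ := h y
  exact ⟨i, hv i (le_antisymm ((hm i).2 y hy) (hi _ (hm i).1))⟩

theorem argmin_injective [Fintype I] (hv : ∀ i, Function.Injective (v i)) (h : IsDominant v S)
    (hc : S.card = Fintype.card I) {m : I → E}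
    (hm : ∀ i, m i ∈ S ∧ ∀ x ∈ S, v i (m i) ≤ v i x) : Function.Injective m := by
  classical
  have himage : Finset.univ.image m = S := by
    ext y
    simp only [Finset.mem_image, Finset.mem_univ, true_and]
    exact ⟨fun ⟨i, hi⟩ => hi ▸ (hm i).1, h.exists_argmin_eq hv hm⟩
  have := Finset.card_image_iff.mp
    (show (Finset.univ.image m).card = (Finset.univ : Finset I).card by
      rw [himage, hc, Finset.card_univ])
  exact fun a b hab => this (by simp) (by simp) hab

end IsDominant

/-- For `m i` the minimum of a set in the `i`-th order, `y` is the `a`-largest among the elements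
that lie above `m i` in every order `i ≠ a`. Such a `y` is the element that can be added to a
dominant set so as to become its new minimum in the order `a`. -/
def IsTopExtension {I E α : Type*} [LinearOrder α] (v : I → E → α) (m : I → E) (a : I) (y : E) :
    Prop :=
  (∀ i, i ≠ a → v i (m i) < v i y) ∧
    ∀ z, (∀ i, i ≠ a → v i (m i) < v i z) → v a z ≤ v a y

section Extension

variable {I E α : Type*} [LinearOrder α] {v : I → E → α} {τ : Finset E} {m : I → E}

theorem IsTopExtension.isDominant_insert [DecidableEq E] (h : IsDominant v τ)
    (hm : ∀ i, m i ∈ τ ∧ ∀ x ∈ τ, v i (m i) ≤ v i x) {a : I} {y : E}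
    (hy : IsTopExtension v m a y) : IsDominant v (insert y τ) := by
  have hya : ∀ x ∈ τ, v a y ≤ v a x := by
    obtain ⟨i, hi⟩ := h y
    by_cases hia : i = a
    · exact hia ▸ hi
    · exact absurd (hi _ (hm i).1) (not_le.2 (hy.1 i hia))
  intro z
  by_cases hz : ∀ i, i ≠ a → v i (m i) < v i z
  · refine ⟨a, fun x hx => ?_⟩
    rcases Finset.mem_insert.1 hx with rfl | hx
    · exact hy.2 z hz
    · exact (hy.2 z hz).trans (hya x hx)
  · push Not at hz
    obtain ⟨i, hia, hzi⟩ := hz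
    refine ⟨i, fun x hx => ?_⟩
    rcases Finset.mem_insert.1 hx with rfl | hx
    · exact hzi.trans (hy.1 i hia).le
    · exact hzi.trans ((hm i).2 x hx)

/-- If `a` and `b` have the same minimum, then each element of `τ` is the minimum in some order
other than `a`, which is impossible for a top extension at `a`. -/
theorem IsTopExtension.notMem (hv : ∀ i, Function.Injective (v i)) (h : IsDominant v τ)
    (hm : ∀ i, m i ∈ τ ∧ ∀ x ∈ τ, v i (m i) ≤ v i x) {a b : I} (hab : a ≠ b) (hmab : m a = m b)
    {y : E} (hy : IsTopExtension v m a y) : y ∉ τ := by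
  intro hyτ
  obtain ⟨i, rfl⟩ := h.exists_argmin_eq hv hm hyτ
  by_cases hia : i = a
  · subst hia
    have := hy.1 b hab.symm
    rw [hmab] at this
    exact lt_irrefl _ this
  · exact lt_irrefl _ (hy.1 i hia)

theorem IsTopExtension.ne (h : IsDominant v τ) (hm : ∀ i, m i ∈ τ) {a b : I} (hab : a ≠ b)
    {y z : E} (hy : IsTopExtension v m a y) (hz : IsTopExtension v m b z) : y ≠ z := by
  rintro rfl
  obtain ⟨i, hi⟩ := h y
  refine absurd (hi _ (hm i)) (not_le.2 ?_)
  by_cases hia : i = a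
  · exact hz.1 i (hia ▸ hab)
  · exact hy.1 i hia

theorem IsTopExtension.unique (hv : ∀ i, Function.Injective (v i)) {a : I} {y z : E}
    (hy : IsTopExtension v m a y) (hz : IsTopExtension v m a z) : y = z :=
  hv a (le_antisymm (hz.2 y hy.1) (hy.2 z hz.1))

theorem exists_isTopExtension [Finite E] {a : I} {y : E}
    (hy : ∀ i, i ≠ a → v i (m i) < v i y) : ∃ z, IsTopExtension v m a z := by
  obtain ⟨z, hz, hmax⟩ := Set.exists_max_image {z | ∀ i, i ≠ a → v i (m i) < v i z} (v a)
    (Set.toFinite _) ⟨y, hy⟩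
  exact ⟨z, hz, hmax⟩

/-- In a dominant set with as many elements as there are orders, each element is the minimum in
exactly one order. So if `m a = m b`, then the added element `y` has to take over as the minimum at
`a` or at `b`. -/
theorem isTopExtension_or_of_isDominant_insert [Fintype I] [DecidableEq E]
    (hv : ∀ i, Function.Injective (v i))
    (hm : ∀ i, m i ∈ τ ∧ ∀ x ∈ τ, v i (m i) ≤ v i x) {a b : I} (hab : a ≠ b) (hmab : m a = m b)
    (hc : τ.card + 1 = Fintype.card I) {y : E} (hyτ : y ∉ τ) (hy : IsDominant v (insert y τ)) :
    IsTopExtension v m a y ∨ IsTopExtension v m b y := by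
  classical
  have hμ : ∀ i, ∃ z ∈ insert y τ, ∀ x ∈ insert y τ, v i z ≤ v i x := fun i =>
    Finset.exists_min_image _ (v i) ⟨y, Finset.mem_insert_self _ _⟩
  -- `μ i` is the minimum of the enlarged set, which is `m i` unless it is `y`.
  choose μ hμ1 hμ2 using hμ
  have hμm : ∀ i, μ i ≠ y → μ i = m i := fun i hi =>
    hv i (le_antisymm (hμ2 i _ (Finset.mem_insert_of_mem (hm i).1))
      ((hm i).2 _ (Finset.mem_of_mem_insert_of_ne (hμ1 i) hi)))
  have hinj := hy.argmin_injective hv (by rw [Finset.card_insert_of_notMem hyτ, hc])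
    (fun i => ⟨hμ1 i, hμ2 i⟩)
  have key : ∀ k, μ k = y → IsTopExtension v m k y := by
    intro k hk
    have hlt : ∀ i, i ≠ k → v i (m i) < v i y := by
      intro i hi
      have hiy : μ i ≠ y := fun h => hi (hinj (h.trans hk.symm))
      rw [← hμm i hiy]
      exact lt_of_le_of_ne (hμ2 i y (Finset.mem_insert_self _ _)) fun h => hiy (hv i h)
    refine ⟨hlt, fun z hz => ?_⟩
    obtain ⟨i, hi⟩ := hy z
    by_cases hik : i = k
    · exact hik ▸ hi y (Finset.mem_insert_self _ _)
    · exact absurd (hi _ (Finset.mem_insert_of_mem (hm i).1)) (not_le.2 (hz i hik))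
  by_cases ha : μ a = y
  · exact Or.inl (key a ha)
  by_cases hb : μ b = y
  · exact Or.inr (key b hb)
  · exact absurd (hinj ((hμm a ha).trans (hmab.trans (hμm b hb).symm))) hab

theorem exists_eq_insert_of_subset_of_card [DecidableEq E] {S : Finset E} (h : τ ⊆ S)
    (hc : τ.card + 1 = S.card) : ∃ y, y ∉ τ ∧ insert y τ = S :=
  Finset.exists_eq_insert_iff.2 ⟨h, hc⟩

end Extension

section Parity

variable {I E α : Type*} [Fintype I] [Fintype E] [DecidableEq E] [LinearOrder α]
  {v : I → E → α} {s : I → E} {τ : Finset E}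

open scoped Classical in
/-- A set `τ` with one element fewer than there are orders, not all of them slack elements, lies in
either no or exactly two dominant sets of full size. By the pigeonhole principle two orders `a`, `b`
share their minimum on `τ`, and the two ways to enlarge `τ` are its top extensions at `a` and at
`b`; these exist because the slack elements `s a` and `s b` are admissible in their definition. -/
theorem even_card_rooms_of_door (hv : ∀ i, Function.Injective (v i))
    (hs : ∀ i j y, j ≠ i → y ∉ Set.range s → v i y < v i (s j))
    (hc : τ.card + 1 = Fintype.card I) {t : E} (ht : t ∈ τ) (hts : t ∉ Set.range s) :
    Even (Finset.univ.filter fun S : Finset E =>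
      (IsDominant v S ∧ S.card = Fintype.card I) ∧ τ ⊆ S).card := by
  by_cases h : IsDominant v τ
  swap
  · rw [Finset.filter_false_of_mem]
    · simp
    · exact fun S _ hS => h (hS.1.1.mono hS.2)
  have hm : ∀ i, ∃ z ∈ τ, ∀ x ∈ τ, v i z ≤ v i x := fun i =>
    Finset.exists_min_image _ (v i) ⟨t, ht⟩
  choose m hm1 hm2 using hm
  have hm : ∀ i, m i ∈ τ ∧ ∀ x ∈ τ, v i (m i) ≤ v i x := fun i => ⟨hm1 i, hm2 i⟩
  obtain ⟨a, -, b, -, hab, hmab⟩ := Finset.exists_ne_map_eq_of_card_lt_of_maps_to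
    (s := (Finset.univ : Finset I)) (t := τ) (by rw [Finset.card_univ]; omega)
    (f := m) (fun i _ => hm1 i)
  have hex : ∀ a, ∃ z, IsTopExtension v m a z := fun a =>
    exists_isTopExtension (y := s a) fun i hi =>
      ((hm i).2 t ht).trans_lt (hs i a t hi.symm hts)
  obtain ⟨y, hy⟩ := hex a
  obtain ⟨z, hz⟩ := hex b
  have hyτ := hy.notMem hv h hm hab hmab
  have hzτ := hz.notMem hv h hm hab.symm hmab.symm
  have hset : (Finset.univ.filter fun S : Finset E =>
      (IsDominant v S ∧ S.card = Fintype.card I) ∧ τ ⊆ S) = {insert y τ, insert z τ} := by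
    ext S
    simp only [Finset.mem_filter, Finset.mem_univ, true_and, Finset.mem_insert,
      Finset.mem_singleton]
    constructor
    · rintro ⟨⟨hS, hSc⟩, hτS⟩
      obtain ⟨w, hw, rfl⟩ := exists_eq_insert_of_subset_of_card hτS (hc.trans hSc.symm)
      rcases isTopExtension_or_of_isDominant_insert hv hm hab hmab hc hw hS with h1 | h1
      · exact Or.inl (by rw [h1.unique hv hy])
      · exact Or.inr (by rw [h1.unique hv hz])
    · rintro (rfl | rfl)
      · exact ⟨⟨hy.isDominant_insert h hm, by rw [Finset.card_insert_of_notMem hyτ, hc]⟩,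
          Finset.subset_insert _ _⟩
      · exact ⟨⟨hz.isDominant_insert h hm, by rw [Finset.card_insert_of_notMem hzτ, hc]⟩,
          Finset.subset_insert _ _⟩
  rw [hset, Finset.card_pair]
  · exact even_two
  · intro heq
    have : y ∈ insert z τ := heq ▸ Finset.mem_insert_self _ _
    exact (Finset.mem_insert.1 this).elim (hy.ne h hm1 hab hz) hyτ

variable [DecidableEq I]

open scoped Classical in
/-- The set of all slack elements but `s a` lies in exactly one dominant set of full size: it has to
be enlarged by the `a`-largest element that is not slack. -/
theorem card_rooms_of_slack_door (hv : ∀ i, Function.Injective (v i))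
    (hsi : Function.Injective s)
    (hmin : ∀ i y, v i (s i) ≤ v i y)
    (hs : ∀ i j y, j ≠ i → y ∉ Set.range s → v i y < v i (s j))
    {t : E} (hts : t ∉ Set.range s) (a : I) :
    (Finset.univ.filter fun S : Finset E => (IsDominant v S ∧ S.card = Fintype.card I) ∧
      (Finset.univ.erase a).image s ⊆ S).card = 1 := by
  set τ := (Finset.univ.erase a).image s with hτ
  have hc : τ.card + 1 = Fintype.card I := by
    rw [hτ, Finset.card_image_of_injective _ hsi, Finset.card_erase_of_mem (Finset.mem_univ _),
      Finset.card_univ]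
    have : 0 < Fintype.card I := Fintype.card_pos_iff.2 ⟨a⟩
    omega
  have hmem : ∀ i, i ≠ a → s i ∈ τ := fun i hi =>
    Finset.mem_image_of_mem _ (Finset.mem_erase.2 ⟨hi, Finset.mem_univ _⟩)
  have hlt : ∀ i y, y ∉ Set.range s → v i (s i) < v i y := fun i y hy =>
    lt_of_le_of_ne (hmin i y) fun h => hy ⟨i, hv i h⟩
  obtain ⟨y, hy, hmax⟩ := Set.exists_max_image (Set.range s)ᶜ (v a) (Set.toFinite _) ⟨t, hts⟩
  have hyτ : y ∉ τ := fun h => by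
    obtain ⟨i, -, rfl⟩ := Finset.mem_image.1 h
    exact hy ⟨i, rfl⟩
  rw [Finset.card_eq_one]
  refine ⟨insert y τ, ?_⟩
  ext S
  simp only [Finset.mem_filter, Finset.mem_univ, true_and, Finset.mem_singleton]
  constructor
  · rintro ⟨⟨hS, hSc⟩, hτS⟩
    obtain ⟨w, hw, rfl⟩ := exists_eq_insert_of_subset_of_card hτS (hc.trans hSc.symm)
    obtain ⟨i, hi⟩ := hS y
    have hia : i = a := by
      by_contra hia
      exact absurd (hi _ (Finset.mem_insert_of_mem (hmem i hia))) (not_le.2 (hlt i y hy))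
    subst hia
    have hyw := hi w (Finset.mem_insert_self _ _)
    have hws : w ∉ Set.range s := by
      rintro ⟨k, rfl⟩
      by_cases hk : k = i
      · subst hk
        exact absurd hyw (not_le.2 (hlt _ y hy))
      · exact hw (hmem k hk)
    rw [hv i (le_antisymm hyw (hmax w hws))]
  · rintro rfl
    refine ⟨⟨fun z => ?_, by rw [Finset.card_insert_of_notMem hyτ, hc]⟩,
      Finset.subset_insert _ _⟩
    by_cases hz : z ∈ Set.range s
    · obtain ⟨i, rfl⟩ := hz
      exact ⟨i, fun x _ => hmin i x⟩
    · refine ⟨a, fun x hx => ?_⟩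
      rcases Finset.mem_insert.1 hx with rfl | hx
      · exact hmax z hz
      · obtain ⟨i, hi, rfl⟩ := Finset.mem_image.1 hx
        exact (hs a i z (Finset.ne_of_mem_erase hi) hz).le

/-- A set of full size that misses a color has either no or exactly two subsets with one element
fewer that show every color but `a`: some color is repeated, and one or the other of the two
elements of that color has to be left out. -/
theorem even_card_doors_of_room {c : E → I} {a : I} {S : Finset E} (hS : S.card = Fintype.card I)
    (hne : S.image c ≠ Finset.univ) :
    Even (Finset.univ.filter fun τ : Finset E =>
      (τ.image c = Finset.univ.erase a ∧ τ.card + 1 = Fintype.card I) ∧ τ ⊆ S).card := by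
  have hinj : ∀ τ : Finset E, τ.image c = Finset.univ.erase a → τ.card + 1 = Fintype.card I →
      Set.InjOn c τ := by
    intro τ h1 h2
    rw [← Finset.card_image_iff, h1, Finset.card_erase_of_mem (Finset.mem_univ _),
      Finset.card_univ]
    omega
  rcases Finset.eq_empty_or_nonempty (Finset.univ.filter fun τ : Finset E =>
      (τ.image c = Finset.univ.erase a ∧ τ.card + 1 = Fintype.card I) ∧ τ ⊆ S) with h | ⟨τ, h⟩
  · rw [h]; simp
  simp only [Finset.mem_filter, Finset.mem_univ, true_and] at h
  obtain ⟨⟨hτ, hτc⟩, hτS⟩ := h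
  obtain ⟨x, hx, rfl⟩ := exists_eq_insert_of_subset_of_card hτS (hτc.trans hS.symm)
  have hxa : c x ≠ a := by
    intro hxa
    apply hne
    rw [Finset.image_insert, hτ, hxa, Finset.insert_erase (Finset.mem_univ _)]
  obtain ⟨x', hx', hcx⟩ : ∃ x' ∈ τ, c x' = c x := by
    rw [← Finset.mem_image, hτ]
    exact Finset.mem_erase.2 ⟨hxa, Finset.mem_univ _⟩
  have hxx' : x ≠ x' := fun h => hx (h ▸ hx')
  have hset : (Finset.univ.filter fun ρ : Finset E =>
      (ρ.image c = Finset.univ.erase a ∧ ρ.card + 1 = Fintype.card I) ∧ ρ ⊆ insert x τ) =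
      {τ, insert x (τ.erase x')} := by
    ext ρ
    simp only [Finset.mem_filter, Finset.mem_univ, true_and, Finset.mem_insert,
      Finset.mem_singleton]
    constructor
    · rintro ⟨⟨hρ, hρc⟩, hρS⟩
      obtain ⟨w, hw, hwS⟩ := exists_eq_insert_of_subset_of_card hρS (hρc.trans hS.symm)
      have hρw : ρ = (insert x τ).erase w := by rw [← hwS, Finset.erase_insert hw]
      by_cases hwx : w = x
      · left
        rw [hρw, hwx, Finset.erase_insert hx]
      by_cases hwx' : w = x'
      · right
        rw [hρw, hwx', Finset.erase_insert_of_ne hxx']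
      · exfalso
        refine hxx' (hinj ρ hρ hρc ?_ ?_ hcx.symm)
        · rw [hρw]; simp [Ne.symm hwx]
        · rw [hρw]; simp [Ne.symm hwx', hx']
    · rintro (rfl | rfl)
      · exact ⟨⟨hτ, hτc⟩, hτS⟩
      · refine ⟨⟨?_, ?_⟩, Finset.insert_subset_insert _ (Finset.erase_subset _ _)⟩
        · rw [Finset.image_insert, ← hcx, ← Finset.image_insert, Finset.insert_erase hx', hτ]
        · rw [Finset.card_insert_of_notMem (fun h => hx (Finset.mem_of_mem_erase h)),
            Finset.card_erase_add_one hx', hτc]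
  rw [hset, Finset.card_pair]
  · exact even_two
  · intro h
    exact hx (h ▸ Finset.mem_insert_self _ _)

/-- **Scarf's lemma** for colorings. The slack element `s i` is the least element in the `i`-th
order and exceeds all non-slack elements in the other orders. If `s i` has color `i`, then some
dominant set shows each color exactly once. -/
theorem exists_rainbow_isDominant [Nonempty I] (hv : ∀ i, Function.Injective (v i))
    (hsi : Function.Injective s)
    (hmin : ∀ i y, v i (s i) ≤ v i y)
    (hs : ∀ i j y, j ≠ i → y ∉ Set.range s → v i y < v i (s j))
    (hne : ∃ t, t ∉ Set.range s) {c : E → I} (hcs : ∀ i, c (s i) = i) :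
    ∃ S : Finset E, IsDominant v S ∧ S.card = Fintype.card I ∧ S.image c = Finset.univ := by
  classical
  by_contra! hno
  obtain ⟨a⟩ := ‹Nonempty I›
  obtain ⟨t, ht⟩ := hne
  set R := Finset.univ.filter fun S : Finset E => IsDominant v S ∧ S.card = Fintype.card I with hR
  set D := Finset.univ.filter fun τ : Finset E =>
    τ.image c = Finset.univ.erase a ∧ τ.card + 1 = Fintype.card I with hD
  -- The inclusions `τ ⊆ S` of a door `τ ∈ D` in a room `S ∈ R` are counted in two ways.
  have hdouble := Finset.sum_card_bipartiteAbove_eq_sum_card_bipartiteBelow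
    (s := D) (t := R) (fun τ S : Finset E => τ ⊆ S)
  have heven : Even (∑ S ∈ R, (Finset.bipartiteBelow (fun τ S : Finset E => τ ⊆ S) D S).card) := by
    refine Finset.even_sum _ fun S hS => ?_
    have hS := (Finset.mem_filter.1 hS).2
    rw [Finset.bipartiteBelow, hD, Finset.filter_filter]
    exact even_card_doors_of_room hS.2 (hno S hS.1 hS.2)
  have hτc : ((Finset.univ.erase a).image s).card + 1 = Fintype.card I := by
    rw [Finset.card_image_of_injective _ hsi, Finset.card_erase_add_one (Finset.mem_univ _),
      Finset.card_univ]
  have hmem : (Finset.univ.erase a).image s ∈ D := by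
    refine Finset.mem_filter.2 ⟨Finset.mem_univ _, ?_, hτc⟩
    rw [Finset.image_image, show c ∘ s = id from funext hcs, Finset.image_id]
  rw [← hdouble, ← Finset.add_sum_erase _ _ hmem] at heven
  have hone : (Finset.bipartiteAbove (fun τ S : Finset E => τ ⊆ S) R
      ((Finset.univ.erase a).image s)).card = 1 := by
    rw [Finset.bipartiteAbove, hR, Finset.filter_filter]
    exact card_rooms_of_slack_door hv hsi hmin hs ht a
  have hrest : Even (∑ τ ∈ D.erase ((Finset.univ.erase a).image s),
      (Finset.bipartiteAbove (fun τ S : Finset E => τ ⊆ S) R τ).card) := by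
    refine Finset.even_sum _ fun τ hτ => ?_
    obtain ⟨hτne, hτD⟩ := Finset.mem_erase.1 hτ
    obtain ⟨-, hτ1, hτ2⟩ := Finset.mem_filter.1 hτD
    rw [Finset.bipartiteAbove, hR, Finset.filter_filter]
    -- The only door that consists of slack elements is the one taken out of the sum.
    obtain ⟨u, hu, hus⟩ : ∃ u ∈ τ, u ∉ Set.range s := by
      by_contra! hall
      refine hτne (Finset.eq_of_subset_of_card_le (fun u hu => ?_) (by omega))
      obtain ⟨i, rfl⟩ := hall u hu
      refine Finset.mem_image_of_mem _ ?_
      simpa only [hτ1, hcs] using Finset.mem_image_of_mem c hu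
    exact even_card_rooms_of_door hv hs hτ2 hu hus
  rw [hone] at heven
  exact absurd (heven.add hrest) (by
    rw [add_assoc, ← two_mul]
    simp [Nat.even_add])

end Parity

/-! ### Limits of thickenings -/

open Filter Topology

theorem IsClosed.mem_of_frequently_mem_thickening {X ι : Type*} [PseudoMetricSpace X]
    {l : Filter ι} {B : Set X} (hB : IsClosed B) {x : ι → X} {a : X} {ε : ι → ℝ}
    (hx : Tendsto x l (𝓝 a)) (hε : Tendsto ε l (𝓝 0))
    (h : ∃ᶠ k in l, x k ∈ Metric.thickening (ε k) B) : a ∈ B := by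
  rw [← hB.closure_eq, Metric.mem_closure_iff]
  intro r hr
  have h1 : ∀ᶠ k in l, dist (x k) a < r / 2 := Metric.tendsto_nhds.1 hx _ (half_pos hr)
  have h2 : ∀ᶠ k in l, ε k < r / 2 := hε.eventually_lt_const (half_pos hr)
  obtain ⟨k, hk, hk1, hk2⟩ := (h.and_eventually (h1.and h2)).exists
  obtain ⟨b, hb, hdist⟩ := Metric.mem_thickening_iff.1 hk
  refine ⟨b, hb, ?_⟩
  have := dist_triangle_left a b (x k)
  linarith

/-! ### Coverings of the simplex -/

section KKM

variable {I : Type*} [Fintype I]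

/-- For every coloring of the simplex there is a point that has, for each `i` in its support, a
point of color `i` nearby. Scarf's lemma is applied to a finite net, ordered by the `i`-th
coordinates, with slack elements added. If `C` is the set of those `i` whose slack element is not in the dominant set,
dominance says that no point of the net exceeds in all coordinates `i ∈ C` the minima over the
dominant set. So these minima add up to almost `1`, which makes the points in the dominant set close
to each other and almost supported on `C`. -/
theorem exists_mem_thickening_color [Nonempty I] (c : stdSimplex ℝ I → I) {ε : ℝ} (hε : 0 < ε) :
    ∃ z : stdSimplex ℝ I, ∀ i, 0 < z.1 i → z ∈ Metric.thickening ε {x | c x = i} := by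
  classical
  set n : ℝ := (Fintype.card I : ℝ) with hn
  have hn0 : 0 ≤ n := Nat.cast_nonneg _
  -- All coordinates of two points can be compared up to `δ`, and the sum constraint turns this into
  -- a distance of at most `n * δ`.
  set δ : ℝ := ε / (n + 1) with hδ
  have hδ0 : 0 < δ := by positivity
  have hδε : n * δ < ε := by
    have : (n + 1) * δ = ε := by rw [hδ]; field_simp
    linarith
  obtain ⟨T, -, hTfin, hT⟩ := (isCompact_univ (X := stdSimplex ℝ I)).finite_cover_balls hδ0
  lift T to Finset (stdSimplex ℝ I) using hTfin
  have hnet : ∀ z : stdSimplex ℝ I, ∃ t : T, ∀ i, z.1 i < t.1.1 i + δ := by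
    intro z
    obtain ⟨t, ht, hzt⟩ := Set.mem_iUnion₂.1 (hT (Set.mem_univ z))
    refine ⟨⟨t, ht⟩, fun i => ?_⟩
    have h1 : dist (z.1 i) (t.1 i) ≤ dist z t := dist_le_pi_dist z.1 t.1 i
    have h2 := (abs_lt.1 (h1.trans_lt hzt)).2
    linarith
  have hcoord : ∀ (x : stdSimplex ℝ I) i, x.1 i ≤ 1 := fun x i => by
    rw [← x.2.2]
    exact Finset.single_le_sum (fun k _ => x.2.1 k) (Finset.mem_univ i)
  -- The numbering `e` breaks the ties between equal coordinates. The coordinates `-1` and `2` put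
  -- the slack elements below and above all points of the simplex.
  let w : I → T ⊕ I → ℝ := fun i => Sum.elim (fun t => t.1.1 i) fun j => if j = i then -1 else 2
  let e := Fintype.equivFin (T ⊕ I)
  let v : I → T ⊕ I → ℝ ×ₗ Fin (Fintype.card (T ⊕ I)) := fun i y => toLex (w i y, e y)
  have hlt : ∀ {i x y}, w i x < w i y → v i x < v i y := fun h =>
    Prod.Lex.toLex_lt_toLex.2 (Or.inl h)
  have hle : ∀ {i x y}, v i x ≤ v i y → w i x ≤ w i y := fun h => by
    by_contra hcon
    exact absurd h (not_le.2 (hlt (not_le.1 hcon)))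
  have hv : ∀ i, Function.Injective (v i) := fun i x y hxy => by
    have := congrArg (fun p => (ofLex p).2) hxy
    exact e.injective this
  have hmin : ∀ i y, v i (Sum.inr i) ≤ v i y := by
    rintro i (t | j)
    · refine (hlt ?_).le
      have := t.1.2.1 i
      simp only [w, Sum.elim_inl, Sum.elim_inr, if_true]
      linarith
    · by_cases hj : j = i
      · rw [hj]
      · refine (hlt ?_).le
        simp only [w, Sum.elim_inr, if_true, if_neg hj]
        norm_num
  have hs : ∀ i j y, j ≠ i → y ∉ Set.range (Sum.inr : I → T ⊕ I) → v i y < v i (Sum.inr j) := by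
    rintro i j (t | k) hji hy
    · refine hlt ?_
      have := hcoord t.1 i
      simp only [w, Sum.elim_inl, Sum.elim_inr, if_neg hji]
      linarith
    · exact absurd ⟨k, rfl⟩ hy
  obtain ⟨i₀⟩ := ‹Nonempty I›
  obtain ⟨t₀, -⟩ := hnet (stdSimplex.vertex i₀)
  obtain ⟨S, hS, -, hSc⟩ := exists_rainbow_isDominant hv Sum.inr_injective hmin hs
    ⟨Sum.inl t₀, by simp⟩ (c := Sum.elim (fun t => c t.1) id) fun i => rfl
  have hdom : ∀ t : T, ∃ i, Sum.inr i ∉ S ∧ ∀ u : T, Sum.inl u ∈ S → t.1.1 i ≤ u.1.1 i := by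
    intro t
    obtain ⟨i, hi⟩ := hS (Sum.inl t)
    refine ⟨i, fun hiS => ?_, fun u hu => hle (hi _ hu)⟩
    have h1 := hle (hi _ hiS)
    have h2 := t.1.2.1 i
    simp only [w, Sum.elim_inl, Sum.elim_inr, if_true] at h1
    linarith
  have hcolor : ∀ i, Sum.inr i ∉ S → ∃ u : T, Sum.inl u ∈ S ∧ c u.1 = i := by
    intro i hi
    obtain ⟨y, hy, hyi⟩ := Finset.mem_image.1 (hSc ▸ Finset.mem_univ i)
    rcases y with u | j
    · exact ⟨u, hy, hyi⟩
    · have : j = i := hyi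
      exact absurd (this ▸ hy) hi
  obtain ⟨i₁, hi₁, -⟩ := hdom t₀
  obtain ⟨u₀, hu₀, -⟩ := hcolor i₁ hi₁
  have hmex : ∀ i, ∃ u : T, Sum.inl u ∈ S ∧ ∀ u' : T, Sum.inl u' ∈ S → u.1.1 i ≤ u'.1.1 i := by
    intro i
    obtain ⟨u, hu, hu'⟩ := Set.exists_min_image {u : T | Sum.inl u ∈ S} (fun u => u.1.1 i)
      (Set.toFinite _) ⟨u₀, hu₀⟩
    exact ⟨u, hu, hu'⟩
  choose m hmS hm using hmex
  set C : Finset I := Finset.univ.filter fun i => Sum.inr i ∉ S with hC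
  have hCmem : ∀ {i}, i ∈ C ↔ Sum.inr i ∉ S := by simp [hC]
  have hCpos : (0 : ℝ) < C.card := Nat.cast_pos.2 (Finset.card_pos.2 ⟨i₁, hCmem.2 hi₁⟩)
  -- `z` arises from the vector of minima by distributing the missing mass `r` evenly over `C`.
  set r : ℝ := 1 - ∑ i ∈ C, (m i).1.1 i with hr
  have hr0 : 0 ≤ r := by
    have h1 : ∑ i ∈ C, (m i).1.1 i ≤ ∑ i ∈ C, u₀.1.1 i :=
      Finset.sum_le_sum fun i _ => hm i u₀ hu₀
    have h2 : ∑ i ∈ C, u₀.1.1 i ≤ ∑ i, u₀.1.1 i :=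
      Finset.sum_le_sum_of_subset_of_nonneg (Finset.subset_univ _) fun i _ _ => u₀.1.2.1 i
    rw [u₀.1.2.2] at h2
    linarith
  let z : stdSimplex ℝ I := ⟨fun i => if i ∈ C then (m i).1.1 i + r / C.card else 0, by
    intro i
    dsimp only
    split_ifs
    · exact add_nonneg ((m i).1.2.1 i) (by positivity)
    · exact le_rfl, by
    rw [Finset.sum_ite_mem, Finset.univ_inter, Finset.sum_add_distrib, Finset.sum_const,
      nsmul_eq_mul, mul_div_cancel₀ _ hCpos.ne', hr]
    ring⟩
  have hzC : ∀ i, i ∈ C → z.1 i = (m i).1.1 i + r / C.card := fun i hi => if_pos hi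
  have hzC' : ∀ i, i ∉ C → z.1 i = 0 := fun i hi => if_neg hi
  have hrδ : r / C.card ≤ δ := by
    obtain ⟨t, ht⟩ := hnet z
    obtain ⟨i, hi, hit⟩ := hdom t
    have h1 := ht i
    rw [hzC i (hCmem.2 hi)] at h1
    have h2 := hit _ (hmS i)
    linarith
  refine ⟨z, fun i hi => ?_⟩
  have hiC : i ∈ C := by
    by_contra h
    exact absurd (hzC' i h) hi.ne'
  obtain ⟨u, hu, hui⟩ := hcolor i (hCmem.1 hiC)
  refine Metric.mem_thickening_iff.2 ⟨u.1, hui, lt_of_le_of_lt ?_ hδε⟩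
  have hlow : ∀ k, 0 ≤ u.1.1 k - z.1 k + δ := by
    intro k
    by_cases hk : k ∈ C
    · rw [hzC k hk]
      have := hm k u hu
      linarith
    · rw [hzC' k hk]
      have := u.1.2.1 k
      linarith
  have hsum : ∑ k, (u.1.1 k - z.1 k + δ) = n * δ := by
    rw [Finset.sum_add_distrib, Finset.sum_sub_distrib, u.1.2.2, z.2.2, Finset.sum_const,
      nsmul_eq_mul, Finset.card_univ]
    ring
  have h1n : 1 ≤ n := by
    have : 0 < Fintype.card I := Fintype.card_pos_iff.2 ⟨i⟩
    rw [hn]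
    exact_mod_cast this
  have hδn : δ ≤ n * δ := le_mul_of_one_le_left hδ0.le h1n
  refine (dist_pi_le_iff (by positivity)).2 fun k => ?_
  have hup := Finset.single_le_sum (fun k _ => hlow k) (Finset.mem_univ k)
  rw [hsum] at hup
  have := hlow k
  rw [dist_comm, Real.dist_eq, abs_le]
  constructor <;> linarith

/-- The dual form of the **Knaster–Kuratowski–Mazurkiewicz lemma**: if closed sets `B i` cover the
simplex, then some point lies in `B i` for every `i` in its support. -/
theorem exists_forall_pos_mem_of_isClosed_cover [Nonempty I] {B : I → Set (stdSimplex ℝ I)}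
    (hB : ∀ i, IsClosed (B i)) (hcover : ∀ x, ∃ i, x ∈ B i) :
    ∃ z : stdSimplex ℝ I, ∀ i, 0 < z.1 i → z ∈ B i := by
  choose c hc using hcover
  choose z hz using fun k : ℕ =>
    exists_mem_thickening_color c (Nat.one_div_pos_of_nat (α := ℝ) (n := k))
  obtain ⟨a, φ, hφ, hlim⟩ := CompactSpace.tendsto_subseq z
  refine ⟨a, fun i hi => ?_⟩
  have hpos : ∀ᶠ k in atTop, 0 < (z (φ k)).1 i :=
    (((continuous_apply i).comp continuous_subtype_val).tendsto a |>.comp hlim).eventually_const_lt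
      hi
  refine (hB i).mem_of_frequently_mem_thickening hlim
    (tendsto_one_div_add_atTop_nhds_zero_nat.comp hφ.tendsto_atTop) (Eventually.frequently ?_)
  filter_upwards [hpos] with k hk
  exact Metric.thickening_subset_of_subset _ (fun x hx => hx ▸ hc x) (hz (φ k) i hk)

open scoped Classical in
/-- Approximate form of `exists_card_lt_card_neighbors`. The functions `g j` form, for each `j`, a
partition of unity such that `g j i` vanishes where the `i`-th coordinate does and far from `D j i`.
At a point where each column sum `∑ j, g j i` is at most `|J| / |I|`, the rows in `A`, each of
sum `1`, need more than `|A|` columns. Such a point is found by the dual KKM lemma: the sets where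
the `i`-th column sum is small cover the simplex since the average column sum is `|J| / |I|`, and
column sums outside the support vanish. -/
theorem exists_card_lt_card_thickening {J : Type*} [Fintype J]
    (hcard : Fintype.card J + 1 = Fintype.card I) {D : J → I → Set (stdSimplex ℝ I)}
    (hD : ∀ j x, ∃ i, 0 < x.1 i ∧ x ∈ D j i) {ε : ℝ} (hε : 0 < ε) :
    ∃ x : stdSimplex ℝ I, ∀ A : Finset J, A.Nonempty → A.card <
      (Finset.univ.filter fun i => ∃ j ∈ A, x ∈ Metric.thickening ε (D j i)).card := by
  have : Nonempty I := Fintype.card_pos_iff.1 (by omega)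
  let f : J → I → stdSimplex ℝ I → ℝ := fun j i x => x.1 i * thickenedIndicator hε (D j i) x
  have hfc : ∀ j i, Continuous (f j i) := fun j i =>
    ((continuous_apply i).comp continuous_subtype_val).mul
      (NNReal.continuous_coe.comp (thickenedIndicator hε (D j i)).continuous)
  have hf0 : ∀ j i x, 0 ≤ f j i x := fun j i x => mul_nonneg (x.2.1 i) (NNReal.coe_nonneg _)
  have hfx : ∀ j i x, x.1 i = 0 → f j i x = 0 := fun j i x h => by simp only [f, h, zero_mul]
  have hft : ∀ j i x, x ∉ Metric.thickening ε (D j i) → f j i x = 0 := fun j i x h => by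
    simp only [f, thickenedIndicator_zero hε _ h, NNReal.coe_zero, mul_zero]
  have hfpos : ∀ j x, 0 < ∑ i, f j i x := by
    intro j x
    obtain ⟨i, hi, hx⟩ := hD j x
    refine Finset.sum_pos' (fun i _ => hf0 j i x) ⟨i, Finset.mem_univ i, ?_⟩
    simp only [f, thickenedIndicator_one hε _ hx, NNReal.coe_one, mul_one]
    exact hi
  let g : J → I → stdSimplex ℝ I → ℝ := fun j i x => f j i x / ∑ k, f j k x
  have hgc : ∀ j i, Continuous (g j i) := fun j i =>
    (hfc j i).div (continuous_finsetSum _ fun k _ => hfc j k) fun x => (hfpos j x).ne'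
  have hg0 : ∀ j i x, 0 ≤ g j i x := fun j i x => div_nonneg (hf0 j i x) (hfpos j x).le
  have hg1 : ∀ j x, ∑ i, g j i x = 1 := fun j x => by
    rw [← Finset.sum_div, div_self (hfpos j x).ne']
  have hgsum : ∀ (A : Finset J) x, ∑ i, ∑ j ∈ A, g j i x = A.card := fun A x => by
    rw [Finset.sum_comm, Finset.sum_congr rfl fun j _ => hg1 j x]
    simp
  obtain ⟨x, hx⟩ := exists_forall_pos_mem_of_isClosed_cover
    (B := fun i => {x | (Fintype.card I : ℝ) * ∑ j, g j i x ≤ Fintype.card J})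
    (fun i => isClosed_le
      (continuous_const.mul (continuous_finsetSum _ fun j _ => hgc j i)) continuous_const)
    (fun x => by
      by_contra! h
      have h1 := Finset.sum_lt_sum_of_nonempty Finset.univ_nonempty fun i _ =>
        lt_of_not_ge (Set.notMem_ofPred_iff.1 (h i))
      rw [← Finset.mul_sum, hgsum, Finset.sum_const, nsmul_eq_mul] at h1
      exact lt_irrefl _ h1)
  have hcol : ∀ i, (Fintype.card I : ℝ) * ∑ j, g j i x ≤ Fintype.card J := by
    intro i
    rcases (x.2.1 i).eq_or_lt with h | h
    · have : ∑ j, g j i x = 0 := Finset.sum_eq_zero fun j _ => by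
        simp only [g, hfx j i x h.symm, zero_div]
      rw [this, mul_zero]
      exact Nat.cast_nonneg _
    · exact hx i h
  refine ⟨x, fun A hA => ?_⟩
  set N := Finset.univ.filter fun i => ∃ j ∈ A, x ∈ Metric.thickening ε (D j i) with hN
  have hle : (Fintype.card I : ℝ) * A.card ≤ N.card * Fintype.card J := by
    calc (Fintype.card I : ℝ) * A.card = Fintype.card I * ∑ i ∈ N, ∑ j ∈ A, g j i x := by
          rw [← hgsum A x]
          congr 1
          refine (Finset.sum_subset (Finset.subset_univ N) fun i _ hi => ?_).symm
          refine Finset.sum_eq_zero fun j hj => ?_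
          simp only [g]
          rw [hft j i x fun h => hi (Finset.mem_filter.2 ⟨Finset.mem_univ i, j, hj, h⟩), zero_div]
      _ = ∑ i ∈ N, (Fintype.card I : ℝ) * ∑ j ∈ A, g j i x := Finset.mul_sum _ _ _
      _ ≤ ∑ i ∈ N, (Fintype.card J : ℝ) := Finset.sum_le_sum fun i _ =>
          (mul_le_mul_of_nonneg_left (Finset.sum_le_sum_of_subset_of_nonneg (Finset.subset_univ A)
            fun j _ _ => hg0 j i x) (Nat.cast_nonneg _)).trans (hcol i)
      _ = N.card * Fintype.card J := by rw [Finset.sum_const, nsmul_eq_mul]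
  have hle' : Fintype.card I * A.card ≤ N.card * Fintype.card J := by exact_mod_cast hle
  have hApos := hA.card_pos
  by_contra hcon
  have : N.card * Fintype.card J ≤ A.card * Fintype.card J :=
    Nat.mul_le_mul_right _ (not_lt.1 hcon)
  rw [← hcard] at hle'
  nlinarith

open scoped Classical in
/-- Let each of `|I| - 1` families `D j` of closed sets satisfy the condition that every point of
the simplex lies in `D j i` for some `i` in its support. Then some point `x` satisfies Hall's condition
with a surplus of one: for every nonempty set `A` of families, there are more than `|A|` indices `i`
such that `x` lies in `D j i` for some `j ∈ A`. -/
theorem exists_card_lt_card_neighbors {J : Type*} [Fintype J]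
    (hcard : Fintype.card J + 1 = Fintype.card I) {D : J → I → Set (stdSimplex ℝ I)}
    (hclosed : ∀ j i, IsClosed (D j i)) (hD : ∀ j x, ∃ i, 0 < x.1 i ∧ x ∈ D j i) :
    ∃ x : stdSimplex ℝ I, ∀ A : Finset J, A.Nonempty →
      A.card < (Finset.univ.filter fun i => ∃ j ∈ A, x ∈ D j i).card := by
  choose x hx using fun k : ℕ =>
    exists_card_lt_card_thickening hcard hD (Nat.one_div_pos_of_nat (α := ℝ) (n := k))
  obtain ⟨a, φ, hφ, hlim⟩ := CompactSpace.tendsto_subseq x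
  have hev : ∀ᶠ k in atTop, ∀ j i,
      x (φ k) ∈ Metric.thickening (1 / ((φ k : ℝ) + 1)) (D j i) → a ∈ D j i := by
    refine eventually_all.2 fun j => eventually_all.2 fun i => ?_
    by_contra h
    obtain ⟨k, hk⟩ := (not_eventually.1 h).exists
    refine (Classical.not_imp.1 hk).2 ((hclosed j i).mem_of_frequently_mem_thickening hlim
      (tendsto_one_div_add_atTop_nhds_zero_nat.comp hφ.tendsto_atTop) ?_)
    exact (not_eventually.1 h).mono fun k hk => (Classical.not_imp.1 hk).1
  obtain ⟨k, hk⟩ := hev.exists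
  refine ⟨a, fun A hA => (hx (φ k) A hA).trans_le (Finset.card_le_card fun i hi => ?_)⟩
  obtain ⟨-, j, hj, hji⟩ := Finset.mem_filter.1 hi
  exact Finset.mem_filter.2 ⟨Finset.mem_univ i, j, hj, hk j i hji⟩

end KKM

/-! ### Matchings -/

open scoped Classical in
/-- A surplus of one in Hall's condition leaves room to discard any one element `i`. -/
theorem exists_equiv_ne_of_card_lt {J I : Type*} [Fintype J] [Fintype I]
    (hcard : Fintype.card J + 1 = Fintype.card I) {r : J → I → Prop}
    (hr : ∀ A : Finset J, A.Nonempty →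
      A.card < (Finset.univ.filter fun i => ∃ j ∈ A, r j i).card) (i : I) :
    ∃ π : J ≃ {k : I // k ≠ i}, ∀ j, r j (π j) := by
  obtain ⟨f, hf, hfr⟩ := (Finset.all_card_le_biUnion_card_iff_exists_injective
    fun j => Finset.univ.filter fun k => k ≠ i ∧ r j k).1 (by
      intro A
      rcases A.eq_empty_or_nonempty with rfl | hA
      · simp
      have h1 := hr A hA
      have h2 := Finset.pred_card_le_card_erase (a := i)
        (s := Finset.univ.filter fun k => ∃ j ∈ A, r j k)
      refine (show A.card ≤ _ by omega).trans (h2.trans (Finset.card_le_card fun k hk => ?_))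
      obtain ⟨hki, hk⟩ := Finset.mem_erase.1 hk
      obtain ⟨-, j, hj, hjk⟩ := Finset.mem_filter.1 hk
      exact Finset.mem_biUnion.2 ⟨j, hj, Finset.mem_filter.2 ⟨Finset.mem_univ k, hki, hjk⟩⟩)
  have hf' : ∀ j, f j ≠ i ∧ r j (f j) := fun j => (Finset.mem_filter.1 (hfr j)).2
  refine ⟨Equiv.ofBijective (fun j => ⟨f j, (hf' j).1⟩)
    ((Fintype.bijective_iff_injective_and_card _).2 ⟨fun a b h => hf (congrArg Subtype.val h), ?_⟩),
    fun j => (hf' j).2⟩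
  rw [Fintype.card_subtype_compl, Fintype.card_subtype_eq]
  omega

/-! ### Cake division -/

/-- A hungry person weakly prefers some nonempty slice. -/
theorem CakePreferences.IsHungry.exists_pos_mem {n : ℕ} {P : CakePreferences n} (hP : P.IsHungry)
    (x : CakeDivision n) : ∃ i, 0 < x.1 i ∧ x ∈ P.prefSet i := by
  obtain ⟨k, hk⟩ := P.exists_preferred x
  rcases (x.2.1 k).lt_or_eq with hpos | hzero
  · exact ⟨k, hpos, hk⟩
  obtain ⟨i, hi⟩ : ∃ i, 0 < x.1 i := by
    by_contra! h
    have := Finset.sum_nonpos fun i (_ : i ∈ Finset.univ) => h i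
    rw [x.2.2] at this
    exact absurd this (by norm_num)
  refine ⟨i, hi, hP x i k ((x.slice_nonempty_iff i).2 hi) ?_ hk⟩
  rw [← Set.not_nonempty_iff_eq_empty, x.slice_nonempty_iff, ← hzero]
  exact lt_irrefl _

theorem mainTheorem5 (n : ℕ) (s : Fin n)
    (P : {j : Fin n // j ≠ s} → CakePreferences n)
    (hungry : ∀ j, (P j).IsHungry)
    (closed : ∀ j, (P j).HasClosedPrefSets) :
    ∃ x : CakeDivision n,
      (∀ i : Fin n, ∃ π : {j : Fin n // j ≠ s} ≃ {k : Fin n // k ≠ i},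
        ∀ j, x ∈ (P j).prefSet (π j)) ∧
      (∀ Q : Fin n → CakePreferences n, (∀ j : {j : Fin n // j ≠ s}, Q j = P j) →
        ∃ σ : Fin n ≃ Fin n, IsEnvyFree Q x σ) := by
  classical
  have hcard : Fintype.card {j : Fin n // j ≠ s} + 1 = Fintype.card (Fin n) := by
    have : 0 < Fintype.card (Fin n) := Fintype.card_pos_iff.2 ⟨s⟩
    rw [Fintype.card_subtype_compl, Fintype.card_subtype_eq]
    omega
  obtain ⟨x, hx⟩ := exists_card_lt_card_neighbors hcard (D := fun j => (P j).prefSet)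
    closed fun j => (hungry j).exists_pos_mem
  have hπ := exists_equiv_ne_of_card_lt hcard (r := fun j i => x ∈ (P j).prefSet i)
    fun A hA => by convert hx A hA
  refine ⟨x, hπ, fun Q hQ => ?_⟩
  obtain ⟨i, hi⟩ := (Q s).exists_preferred x
  obtain ⟨π, hπ⟩ := hπ i
  have hinj : Function.Injective fun j => if h : j = s then i else (π ⟨j, h⟩).1 := by
    intro a b hab
    dsimp only at hab
    split_ifs at hab with ha hb hb
    · rw [ha, hb]
    · exact absurd hab.symm (π ⟨b, hb⟩).2
    · exact absurd hab (π ⟨a, ha⟩).2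
    · exact congrArg Subtype.val (π.injective (Subtype.ext hab))
  refine ⟨Equiv.ofBijective _ (Finite.injective_iff_bijective.1 hinj), fun j => ?_⟩
  rw [Equiv.ofBijective_apply]
  split_ifs with h
  · exact h ▸ hi
  · rw [hQ ⟨j, h⟩]
    exact hπ ⟨j, h⟩
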